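/- Let $H$ be a Hermitian $d\times d$ matrix with $d$ distinct eigenvalues (the Hamiltonian of a $d$-level battery) and let $\rho$ be a density matrix on $\mathbb C^d$, i.e. a positive semidefinite matrix with $\operatorname{tr}\rho=1$. For $n\ge 1$ let $H^{(n)}=\sum_{k=1}^n H_k$ on $(\mathbb C^d)^{\otimes n}$, where $H_k$ acts as $H$ on the $k$-th tensor factor and as the identity on the others, and let $$w^n_{\max}=\frac1n\Bigl\{\operatorname{tr}\bigl(\rho^{\otimes n}H^{(n)}\bigr)-\min_U\operatorname{tr}\bigl(U\rho^{\otimes n}U^\dagger H^{(n)}\bigr)\Bigr\},$$ where the minimum is over all unitaries $U$ on $(\mathbb C^d)^{\otimes n}$, be the ergotropy per copy of $\rho^{\otimes n}$. For $0\le\beta<\infty$ let $\omega_\beta=e^{-\beta H}/\operatorname{tr}e^{-\beta H}$ be the Gibbs state at inverse temperature $\beta$, and let $\omega_\infty=\lim_{\beta\to\infty}\omega_\beta$ (the projection on the ground state of $H$). Let $S(\sigma)=-\operatorname{tr}\sigma\log\sigma$ be the von Neumann entropy. Then there is exactly one state $\omega_{\overline\beta}$ among the states $\omega_\beta$, $\beta\in[0,\infty]$,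 with $S(\omega_{\overline\beta})=S(\rho)$, and it satisfies $$w^n_{\max}\le\operatorname{tr}(\rho H)-\operatorname{tr}(\omega_{\overline\beta}H)\quad\text{for every }n\ge1,\qquad \lim_{n\to\infty}w^n_{\max}=\operatorname{tr}(\rho H)-\operatorname{tr}(\omega_{\overline\beta}H).$$ -/

import Mathlib

open Filter Topology
open scoped ComplexOrder

namespace QuantumBattery

noncomputable section

/-- A state (density matrix): a positive semidefinite complex matrix of trace one. -/
structure IsDensityMatrix {m : Type*} [Fintype m] (ρ : Matrix m m ℂ) : Prop where
  posSemidef : ρ.PosSemidef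
  trace_eq_one : ρ.trace = 1

/-- The energy `tr (ρ H)`; this trace is real when `ρ` and `H` are Hermitian. -/
def energy {m : Type*} [Fintype m] (ρ H : Matrix m m ℂ) : ℝ :=
  (ρ * H).trace.re

/-- The von Neumann entropy `S(ρ) = - tr (ρ log ρ)`, with `log` taken by functional calculus
(`Real.log 0 = 0`, so that `0 log 0 = 0`). -/
def vonNeumannEntropy {m : Type*} [Fintype m] [DecidableEq m] (ρ : Matrix m m ℂ) : ℝ :=
  -(ρ * cfc Real.log ρ).trace.re

/-- The ergotropy `tr (ρ H) - min_U tr (U ρ U† H)`, over all unitary matrices `U`.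
The infimum is a minimum, by `exists_energy_eq_iInf`. -/
def ergotropy {m : Type*} [Fintype m] [DecidableEq m] (ρ H : Matrix m m ℂ) : ℝ :=
  energy ρ H - ⨅ U : Matrix.unitaryGroup m ℂ,
    energy ((U : Matrix m m ℂ) * ρ * (U : Matrix m m ℂ).conjTranspose) H

/-- The Gibbs state `exp (-β H) / tr (exp (-β H))` at finite inverse temperature `β`. -/
def gibbsState {m : Type*} [Fintype m] [DecidableEq m] (H : Matrix m m ℂ) (β : ℝ) :
    Matrix m m ℂ :=
  (NormedSpace.exp (-(β • H))).trace⁻¹ • NormedSpace.exp (-(β • H))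

/-- `ω` is a Gibbs state of `H` at some inverse temperature `β ∈ [0, ∞]`; the one at `β = ∞` is
the limit of the Gibbs states as `β → ∞` (for nondegenerate `H`, the projection on the
ground state). -/
def IsGibbsState {m : Type*} [Fintype m] [DecidableEq m] (H ω : Matrix m m ℂ) : Prop :=
  (∃ β : ℝ, 0 ≤ β ∧ ω = gibbsState H β) ∨ Tendsto (gibbsState H) atTop (𝓝 ω)

/-- The tensor product `A 0 ⊗ A 1 ⊗ ⋯ ⊗ A (n - 1)`, in the product basis of `(ℂ^d)^{⊗ n}`, which
is indexed by `Fin n → Fin d`. -/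
def tensorProd {n d : ℕ} (A : Fin n → Matrix (Fin d) (Fin d) ℂ) :
    Matrix (Fin n → Fin d) (Fin n → Fin d) ℂ :=
  Matrix.of fun i j => ∏ k, A k (i k) (j k)

/-- The `n`-fold tensor power of `ρ`. -/
def tensorPow {d : ℕ} (n : ℕ) (ρ : Matrix (Fin d) (Fin d) ℂ) :
    Matrix (Fin n → Fin d) (Fin n → Fin d) ℂ :=
  tensorProd fun _ => ρ

/-- The sum Hamiltonian `∑ k, 1 ⊗ ⋯ ⊗ 1 ⊗ H ⊗ 1 ⊗ ⋯ ⊗ 1`, with `H` in the `k`-th factor. -/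
def sumHamiltonian {d : ℕ} (n : ℕ) (H : Matrix (Fin d) (Fin d) ℂ) :
    Matrix (Fin n → Fin d) (Fin n → Fin d) ℂ :=
  ∑ k : Fin n, tensorProd (Function.update (fun _ => 1) k H)

/-- The ergotropy per copy of `n` copies of the battery. -/
def ergotropyPerCopy {d : ℕ} (n : ℕ) (ρ H : Matrix (Fin d) (Fin d) ℂ) : ℝ :=
  ergotropy (tensorPow n ρ) (sumHamiltonian n H) / n

/-- The infimum in the definition of `ergotropy` is attained. -/
theorem exists_energy_eq_iInf {m : Type*} [Fintype m] [DecidableEq m] (ρ H : Matrix m m ℂ) :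
    ∃ V : Matrix.unitaryGroup m ℂ,
      (∀ U : Matrix.unitaryGroup m ℂ,
        energy ((V : Matrix m m ℂ) * ρ * (V : Matrix m m ℂ).conjTranspose) H ≤
          energy ((U : Matrix m m ℂ) * ρ * (U : Matrix m m ℂ).conjTranspose) H) ∧
      energy ((V : Matrix m m ℂ) * ρ * (V : Matrix m m ℂ).conjTranspose) H =
        ⨅ U : Matrix.unitaryGroup m ℂ,
          energy ((U : Matrix m m ℂ) * ρ * (U : Matrix m m ℂ).conjTranspose) H := by
  have hK : IsCompact (Matrix.unitaryGroup m ℂ : Set (Matrix m m ℂ)) := by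
    have hbox : IsCompact (Set.univ.pi fun _ : m => Set.univ.pi fun _ : m =>
        Metric.closedBall (0 : ℂ) 1) :=
      isCompact_univ_pi fun _ => isCompact_univ_pi fun _ => isCompact_closedBall _ _
    refine hbox.of_isClosed_subset ?_ ?_
    · have h : (Matrix.unitaryGroup m ℂ : Set (Matrix m m ℂ)) =
          {A : Matrix m m ℂ | A * A.conjTranspose = 1} := by
        ext A
        exact Matrix.mem_unitaryGroup_iff
      rw [h]
      exact isClosed_eq (by fun_prop) continuous_const
    · intro U hU i _ j _
      rw [mem_closedBall_zero_iff]
      exact entry_norm_bound_of_unitary hU i j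
  have hc : Continuous fun A : Matrix m m ℂ => energy (A * ρ * A.conjTranspose) H :=
    Complex.continuous_re.comp
      (((continuous_id.matrix_mul continuous_const).matrix_mul
        continuous_id.matrix_conjTranspose).matrix_mul continuous_const).matrix_trace
  obtain ⟨V, hV, hmin⟩ := hK.exists_isMinOn
    ⟨1, (Matrix.unitaryGroup m ℂ).one_mem⟩ hc.continuousOn
  have hle : ∀ U : Matrix.unitaryGroup m ℂ, energy (V * ρ * V.conjTranspose) H ≤
      energy ((U : Matrix m m ℂ) * ρ * (U : Matrix m m ℂ).conjTranspose) H :=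
    fun U => isMinOn_iff.1 hmin U U.2
  have hleast : IsLeast (Set.range fun U : Matrix.unitaryGroup m ℂ =>
      energy ((U : Matrix m m ℂ) * ρ * (U : Matrix m m ℂ).conjTranspose) H)
      (energy (V * ρ * V.conjTranspose) H) :=
    ⟨Set.mem_range_self (⟨V, hV⟩ : Matrix.unitaryGroup m ℂ), Set.forall_mem_range.2 hle⟩
  exact ⟨⟨V, hV⟩, hle, hleast.csInf_eq.symm⟩

end

end QuantumBattery

open QuantumBattery

/-! In eigenbases of `H` (levels `E`) and `ρ` (spectrum `p`), a rotated state has energy `∑ |X i j|²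
q j E i` with `X` an arbitrary unitary, so the claims reduce to classical statements about `p` and
the Gibbs weights of `E`.

Upper bound: the Gibbs variational inequality `S(q) ≤ β · energy + log Z` holds on the whole unitary
orbit (`shannonEntropy_le_mixed_energy`). For `n` copies both `S` and `log Z` are `n` times their
one-copy values, and the one-copy Gibbs weights give equality; dividing by `β > 0` bounds the energy
below by `n` times the thermal energy. At `β = 0` the state is maximally mixed and does not move; at
`β = ∞` the bound is the ground energy.

Limit: about `exp (n S(p))` sequences carry almost all of `p ⊗ ⋯ ⊗ p`. If the Gibbs weights at `β`
have strictly more entropy than `p`, still more sequences have mean energy near the thermal one, so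
a permutation moves the likely sequences among them (`eventually_exists_perm`). Weights slightly
hotter than the matching Gibbs state supply the strict gap, at arbitrarily small cost in energy
(`IsGibbsVector.exists_hotter`).

Existence of the Gibbs state is the intermediate value theorem; uniqueness is strict decrease of
entropy in `β`. -/

namespace QuantumBattery

noncomputable section

/-! ### Spectral form of energy, entropy and Gibbs states -/

variable {m : Type*} [Fintype m] [DecidableEq m]

/-- The matrix `W diag(v) W†`. -/
def conjDiag (W : Matrix.unitaryGroup m ℂ) (v : m → ℝ) : Matrix m m ℂ :=
  (W : Matrix m m ℂ) * Matrix.diagonal (fun i => (v i : ℂ)) * (W : Matrix m m ℂ).conjTranspose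

theorem conjTranspose_mul_self_unitary (W : Matrix.unitaryGroup m ℂ) :
    (W : Matrix m m ℂ).conjTranspose * (W : Matrix m m ℂ) = 1 :=
  Matrix.mem_unitaryGroup_iff'.1 W.2

theorem mul_conjTranspose_self_unitary (W : Matrix.unitaryGroup m ℂ) :
    (W : Matrix m m ℂ) * (W : Matrix m m ℂ).conjTranspose = 1 :=
  Matrix.mem_unitaryGroup_iff.1 W.2

theorem conjDiag_isHermitian (W : Matrix.unitaryGroup m ℂ) (v : m → ℝ) :
    (conjDiag W v).IsHermitian := by
  apply Matrix.isHermitian_mul_mul_conjTranspose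
  rw [Matrix.isHermitian_diagonal_iff]
  intro i
  simp [IsSelfAdjoint]

theorem eq_conjDiag {A : Matrix m m ℂ} (hA : A.IsHermitian) :
    A = conjDiag hA.eigenvectorUnitary hA.eigenvalues :=
  hA.spectral_theorem

theorem conjDiag_trace (W : Matrix.unitaryGroup m ℂ) (v : m → ℝ) :
    (conjDiag W v).trace = ((∑ i, v i : ℝ) : ℂ) := by
  rw [conjDiag, Matrix.trace_mul_comm, ← mul_assoc, conjTranspose_mul_self_unitary, one_mul,
    Matrix.trace_diagonal]
  push_cast
  rfl

theorem conjDiag_mul (W : Matrix.unitaryGroup m ℂ) (v w : m → ℝ) :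
    conjDiag W v * conjDiag W w = conjDiag W (fun i => v i * w i) := by
  simp only [conjDiag, mul_assoc]
  rw [← mul_assoc (W : Matrix m m ℂ).conjTranspose, conjTranspose_mul_self_unitary, one_mul,
    ← mul_assoc (Matrix.diagonal _), Matrix.diagonal_mul_diagonal]
  push_cast
  rfl

theorem conjDiag_charpoly (W : Matrix.unitaryGroup m ℂ) (v : m → ℝ) :
    (conjDiag W v).charpoly = ∏ i, (Polynomial.X - Polynomial.C (v i : ℂ)) := by
  rw [conjDiag, Matrix.charpoly_mul_comm, ← mul_assoc, conjTranspose_mul_self_unitary, one_mul,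
    Matrix.charpoly_diagonal]

theorem vonNeumannEntropy_eq_sum_eigenvalues {A : Matrix m m ℂ} (hA : A.IsHermitian) :
    vonNeumannEntropy A = ∑ i, Real.negMulLog (hA.eigenvalues i) := by
  have h1 : A * cfc Real.log A = conjDiag hA.eigenvectorUnitary
      (fun i => hA.eigenvalues i * Real.log (hA.eigenvalues i)) := by
    have h2 : cfc Real.log A =
        conjDiag hA.eigenvectorUnitary (fun i => Real.log (hA.eigenvalues i)) := hA.cfc_eq _
    rw [h2]
    nth_rw 1 [eq_conjDiag hA]
    exact conjDiag_mul _ _ _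
  rw [vonNeumannEntropy, h1, conjDiag_trace, Complex.ofReal_re, ← Finset.sum_neg_distrib]
  simp [Real.negMulLog]

/-- `eigenvalues` lists `v` in its own order, so the two sums are compared over the multiset of
roots of the characteristic polynomial. -/
theorem vonNeumannEntropy_conjDiag (W : Matrix.unitaryGroup m ℂ) (v : m → ℝ) :
    vonNeumannEntropy (conjDiag W v) = ∑ i, Real.negMulLog (v i) := by
  have hA := conjDiag_isHermitian W v
  rw [vonNeumannEntropy_eq_sum_eigenvalues hA]
  have h := hA.roots_charpoly_eq_eigenvalues
  rw [conjDiag_charpoly, Polynomial.roots_prod _ _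
    (by simp [Finset.prod_ne_zero_iff, Polynomial.X_sub_C_ne_zero])] at h
  have h' := congrArg (fun s : Multiset ℂ => (s.map fun z => Real.negMulLog z.re).sum) h
  simpa [Multiset.map_map, Function.comp_def] using h'.symm

theorem energy_conjDiag_self (W : Matrix.unitaryGroup m ℂ) (v E : m → ℝ) :
    energy (conjDiag W v) (conjDiag W E) = ∑ i, v i * E i := by
  rw [energy, conjDiag_mul, conjDiag_trace, Complex.ofReal_re]

theorem energy_diagonal (X : Matrix m m ℂ) (q E : m → ℝ) :
    energy (X * Matrix.diagonal (fun i => (q i : ℂ)) * X.conjTranspose)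
      (Matrix.diagonal (fun i => (E i : ℂ))) =
      ∑ i, ∑ j, Complex.normSq (X i j) * q j * E i := by
  simp only [energy, Matrix.trace, Matrix.diag, Matrix.mul_diagonal, Complex.re_sum]
  refine Finset.sum_congr rfl fun i _ => ?_
  rw [Matrix.mul_apply, Finset.sum_mul, Complex.re_sum]
  refine Finset.sum_congr rfl fun j _ => ?_
  rw [Matrix.mul_diagonal, Matrix.conjTranspose_apply]
  have : X i j * (q j : ℂ) * star (X i j) * (E i : ℂ) =
      ((Complex.normSq (X i j) * q j * E i : ℝ) : ℂ) := by
    push_cast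
    rw [← Complex.mul_conj, starRingEnd_apply]
    ring
  rw [this, Complex.ofReal_re]

/-- The energy of a rotated state, in terms of the unistochastic matrix of the rotation between
the two eigenbases. -/
theorem energy_conj_conjDiag (U V W : Matrix.unitaryGroup m ℂ) (q E : m → ℝ) :
    energy ((U : Matrix m m ℂ) * conjDiag V q * (U : Matrix m m ℂ).conjTranspose)
      (conjDiag W E) =
      ∑ i, ∑ j, Complex.normSq ((W⁻¹ * U * V : Matrix.unitaryGroup m ℂ) i j) * q j * E i := by
  rw [← energy_diagonal]
  have h : ((W⁻¹ * U * V : Matrix.unitaryGroup m ℂ) : Matrix m m ℂ) =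
      (W : Matrix m m ℂ).conjTranspose * U * V := rfl
  rw [h, energy, energy, conjDiag, conjDiag, ← mul_assoc, Matrix.trace_mul_comm]
  simp only [Matrix.conjTranspose_mul, Matrix.conjTranspose_conjTranspose, mul_assoc]

theorem sum_normSq_row (X : Matrix.unitaryGroup m ℂ) (i : m) :
    ∑ j, Complex.normSq (X i j) = 1 := by
  have h := congrFun (congrFun (mul_conjTranspose_self_unitary X) i) i
  rw [Matrix.mul_apply, Matrix.one_apply_eq] at h
  have h2 : ((∑ j, Complex.normSq (X i j) : ℝ) : ℂ) = 1 := by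
    rw [← h]
    push_cast
    exact Finset.sum_congr rfl fun j _ => by
      rw [← Complex.mul_conj, Matrix.conjTranspose_apply, starRingEnd_apply]
  exact_mod_cast h2

theorem sum_normSq_col (X : Matrix.unitaryGroup m ℂ) (j : m) :
    ∑ i, Complex.normSq (X i j) = 1 := by
  have h := sum_normSq_row X⁻¹ j
  have h' : ∀ i, (X⁻¹ : Matrix.unitaryGroup m ℂ) j i = star (X i j) := fun i => rfl
  simpa [h', Complex.normSq_conj] using h

/-- The unitary permutation matrix of `π`. -/
def permUnitary (π : Equiv.Perm m) : Matrix.unitaryGroup m ℂ :=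
  ⟨Equiv.Perm.permMatrix ℂ π, by
    rw [Matrix.mem_unitaryGroup_iff, Matrix.star_eq_conjTranspose,
      Matrix.conjTranspose_permMatrix, ← Matrix.permMatrix_mul]
    simp⟩

theorem normSq_permUnitary (π : Equiv.Perm m) (i j : m) :
    Complex.normSq (permUnitary π i j) = if π i = j then 1 else 0 := by
  change Complex.normSq (Equiv.Perm.permMatrix ℂ π i j) = _
  rw [Equiv.Perm.permMatrix, PEquiv.toMatrix_apply]
  by_cases h : π i = j
  · simp [h]
  · simp [h]

theorem gibbsState_conjDiag (W : Matrix.unitaryGroup m ℂ) (E : m → ℝ) (β : ℝ) :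
    gibbsState (conjDiag W E) β =
      conjDiag W (fun i => Real.exp (-(β * E i)) / ∑ j, Real.exp (-(β * E j))) := by
  have hU : IsUnit (W : Matrix m m ℂ) :=
    IsUnit.of_mul_eq_one _ (mul_conjTranspose_self_unitary W)
  have hinv : (W : Matrix m m ℂ)⁻¹ = (W : Matrix m m ℂ).conjTranspose :=
    Matrix.inv_eq_right_inv (mul_conjTranspose_self_unitary W)
  have h1 : -(β • conjDiag W E) = (W : Matrix m m ℂ) *
      Matrix.diagonal (fun i => ((-(β * E i) : ℝ) : ℂ)) * (W : Matrix m m ℂ)⁻¹ := by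
    rw [hinv, conjDiag, ← neg_smul, ← smul_mul_assoc, ← mul_smul_comm]
    congr 2
    ext i j
    by_cases h : i = j
    · subst h; simp
    · simp [h]
  have h2 : NormedSpace.exp (-(β • conjDiag W E)) =
      conjDiag W (fun i => Real.exp (-(β * E i))) := by
    rw [h1, Matrix.exp_conj _ _ hU, hinv, Matrix.exp_diagonal, conjDiag]
    congr 3
    funext i
    rw [Pi.coe_exp, ← Complex.exp_eq_exp_ℂ, Complex.ofReal_exp]
  rw [gibbsState, h2, conjDiag_trace, conjDiag, conjDiag, ← smul_mul_assoc, ← mul_smul_comm]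
  congr 2
  ext i j
  by_cases h : i = j
  · subst h; simp [div_eq_inv_mul]
  · simp [h]

theorem continuous_conjDiag (W : Matrix.unitaryGroup m ℂ) : Continuous (conjDiag W) := by
  unfold conjDiag
  refine (continuous_const.matrix_mul (Continuous.matrix_diagonal ?_)).matrix_mul continuous_const
  fun_prop

/-! ### Tensor powers in product eigenbases -/

section Tensor

variable {n d : ℕ}

theorem tensorProd_mul (A B : Fin n → Matrix (Fin d) (Fin d) ℂ) :
    tensorProd A * tensorProd B = tensorProd (fun k => A k * B k) := by
  ext i j
  simp only [tensorProd, Matrix.mul_apply, Matrix.of_apply, Finset.prod_univ_sum,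
    Fintype.piFinset_univ, Finset.prod_mul_distrib]

theorem tensorProd_conjTranspose (A : Fin n → Matrix (Fin d) (Fin d) ℂ) :
    (tensorProd A).conjTranspose = tensorProd (fun k => (A k).conjTranspose) := by
  ext i j
  simp [tensorProd, Matrix.conjTranspose_apply]

theorem tensorProd_trace (A : Fin n → Matrix (Fin d) (Fin d) ℂ) :
    (tensorProd A).trace = ∏ k, (A k).trace := by
  simp only [tensorProd, Matrix.trace, Matrix.diag, Matrix.of_apply, Finset.prod_univ_sum,
    Fintype.piFinset_univ]

theorem tensorProd_diagonal (v : Fin n → Fin d → ℂ) :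
    tensorProd (fun k => Matrix.diagonal (v k)) = Matrix.diagonal (fun i => ∏ k, v k (i k)) := by
  ext i j
  simp only [tensorProd, Matrix.of_apply]
  by_cases h : i = j
  · subst h; simp
  · rw [Matrix.diagonal_apply_ne _ h]
    obtain ⟨k, hk⟩ := Function.ne_iff.1 h
    exact Finset.prod_eq_zero (Finset.mem_univ k) (Matrix.diagonal_apply_ne _ hk)

theorem tensorProd_one : tensorProd (fun _ : Fin n => (1 : Matrix (Fin d) (Fin d) ℂ)) = 1 := by
  simpa using tensorProd_diagonal (n := n) (d := d) (fun _ _ => 1)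

/-- The tensor power of a unitary matrix. -/
def unitaryPow (n : ℕ) (W : Matrix.unitaryGroup (Fin d) ℂ) :
    Matrix.unitaryGroup (Fin n → Fin d) ℂ :=
  ⟨tensorPow n (W : Matrix (Fin d) (Fin d) ℂ), by
    rw [Matrix.mem_unitaryGroup_iff, Matrix.star_eq_conjTranspose, tensorPow,
      tensorProd_conjTranspose, tensorProd_mul]
    simp only [mul_conjTranspose_self_unitary, tensorProd_one]⟩

theorem tensorProd_conj (W : Matrix.unitaryGroup (Fin d) ℂ) (v : Fin n → Fin d → ℂ) :
    tensorProd (fun k => (W : Matrix (Fin d) (Fin d) ℂ) * Matrix.diagonal (v k) *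
      (W : Matrix (Fin d) (Fin d) ℂ).conjTranspose) =
      (unitaryPow n W : Matrix (Fin n → Fin d) (Fin n → Fin d) ℂ) *
        Matrix.diagonal (fun i => ∏ k, v k (i k)) *
        (unitaryPow n W : Matrix (Fin n → Fin d) (Fin n → Fin d) ℂ).conjTranspose := by
  rw [← tensorProd_diagonal]
  simp only [unitaryPow, tensorPow, tensorProd_conjTranspose, tensorProd_mul]

theorem tensorPow_conjDiag (W : Matrix.unitaryGroup (Fin d) ℂ) (v : Fin d → ℝ) :
    tensorPow n (conjDiag W v) = conjDiag (unitaryPow n W) (fun f => ∏ k, v (f k)) := by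
  have h := tensorProd_conj (n := n) W (fun _ i => (v i : ℂ))
  simp only [tensorPow, conjDiag, h]
  push_cast
  rfl

/-- Writing each identity factor as `W 1 W†` lets the same `unitaryPow n W` diagonalize every
summand. -/
theorem sumHamiltonian_conjDiag (W : Matrix.unitaryGroup (Fin d) ℂ) (E : Fin d → ℝ) :
    sumHamiltonian n (conjDiag W E) = conjDiag (unitaryPow n W) (fun f => ∑ k, E (f k)) := by
  have h : ∀ k : Fin n, tensorProd (Function.update (fun _ => 1) k (conjDiag W E)) =
      (unitaryPow n W : Matrix (Fin n → Fin d) (Fin n → Fin d) ℂ) *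
        Matrix.diagonal (fun i => (E (i k) : ℂ)) *
        (unitaryPow n W : Matrix (Fin n → Fin d) (Fin n → Fin d) ℂ).conjTranspose := by
    intro k
    have h1 := tensorProd_conj (n := n) W
      (Function.update (fun _ _ => (1 : ℂ)) k (fun i => (E i : ℂ)))
    have h2 : (fun i : Fin n → Fin d => ∏ l, Function.update (fun _ _ => (1 : ℂ)) k
        (fun i => (E i : ℂ)) l (i l)) = fun i => (E (i k) : ℂ) := by
      funext i
      rw [Finset.prod_eq_single k]
      · simp
      · intro b _ hb
        simp [hb]
      · simp
    rw [h2] at h1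
    rw [← h1]
    congr 1
    funext l
    by_cases hl : l = k
    · subst hl
      simp [conjDiag]
    · simp [hl, mul_conjTranspose_self_unitary]
  rw [sumHamiltonian, Finset.sum_congr rfl fun k _ => h k, ← Finset.sum_mul, ← Finset.mul_sum,
    conjDiag]
  congr 2
  ext i j
  by_cases hij : i = j
  · subst hij
    simp [Matrix.sum_apply]
  · simp [Matrix.sum_apply, hij]

theorem energy_tensorPow (ρ H : Matrix (Fin d) (Fin d) ℂ) (hρ : ρ.trace = 1) :
    energy (tensorPow n ρ) (sumHamiltonian n H) = n * energy ρ H := by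
  have h : ∀ k : Fin n, (tensorPow n ρ * tensorProd (Function.update (fun _ => 1) k H)).trace =
      (ρ * H).trace := by
    intro k
    rw [tensorPow, tensorProd_mul, tensorProd_trace, Finset.prod_eq_single k]
    · simp
    · intro b _ hb
      simp [hb, hρ]
    · simp
  rw [energy, sumHamiltonian, Finset.mul_sum, Matrix.trace_sum, Finset.sum_congr rfl fun k _ => h k]
  simp [energy]

end Tensor

/-! ### Classical Gibbs weights and Shannon entropy -/

section Classical

variable {ι : Type*} [Fintype ι]

/-- The Gibbs weights of the energies `E` at inverse temperature `β`. -/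
def gibbsWeight (E : ι → ℝ) (β : ℝ) (i : ι) : ℝ :=
  Real.exp (-(β * E i)) / ∑ j, Real.exp (-(β * E j))

/-- The Shannon entropy of a probability vector. -/
def shannonEntropy (p : ι → ℝ) : ℝ := ∑ i, Real.negMulLog (p i)

/-- For `q > 0` this is `log x < x - 1` at `x = g / q`, multiplied by `q`. Summed over a probability
vector it gives positivity of relative entropy. -/
theorem negMulLog_add_mul_log_lt {q g : ℝ} (hq : 0 ≤ q) (hg : 0 < g) (h : q ≠ g) :
    Real.negMulLog q + q * Real.log g < g - q := by
  rcases hq.eq_or_lt with rfl | hq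
  · simpa using hg
  · have h1 : Real.log (g / q) < g / q - 1 :=
      Real.log_lt_sub_one_of_pos (by positivity) (by
        intro h2
        rw [div_eq_one_iff_eq hq.ne'] at h2
        exact h h2.symm)
    have h2 := mul_lt_mul_of_pos_left h1 hq
    rw [Real.log_div hg.ne' hq.ne'] at h2
    have h3 : q * (g / q - 1) = g - q := by field_simp
    rw [h3] at h2
    rw [Real.negMulLog]
    linarith

theorem negMulLog_add_mul_log_le {q g : ℝ} (hq : 0 ≤ q) (hg : 0 < g) :
    Real.negMulLog q + q * Real.log g ≤ g - q := by
  rcases eq_or_ne q g with rfl | h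
  · simp [Real.negMulLog]
  · exact (negMulLog_add_mul_log_lt hq hg h).le

theorem shannonEntropy_add_lt {q g : ι → ℝ} (hq : ∀ i, 0 ≤ q i) (hg : ∀ i, 0 < g i)
    (hs : ∑ i, q i = ∑ i, g i) (h : q ≠ g) :
    shannonEntropy q + ∑ i, q i * Real.log (g i) < 0 := by
  obtain ⟨i, hi⟩ := Function.ne_iff.1 h
  rw [shannonEntropy, ← Finset.sum_add_distrib]
  have : ∑ i, (Real.negMulLog (q i) + q i * Real.log (g i)) < ∑ i, (g i - q i) :=
    Finset.sum_lt_sum (fun i _ => negMulLog_add_mul_log_le (hq i) (hg i))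
      ⟨i, Finset.mem_univ i, negMulLog_add_mul_log_lt (hq i) (hg i) hi⟩
  rwa [Finset.sum_sub_distrib, hs, sub_self] at this

theorem shannonEntropy_nonneg {q : ι → ℝ} (hq : ∀ i, 0 ≤ q i) (hs : ∑ i, q i = 1) :
    0 ≤ shannonEntropy q :=
  Finset.sum_nonneg fun i _ => Real.negMulLog_nonneg (hq i)
    (hs ▸ Finset.single_le_sum (fun j _ => hq j) (Finset.mem_univ i))

theorem gibbsWeight_zero (E : ι → ℝ) : gibbsWeight E 0 = fun _ => (Fintype.card ι : ℝ)⁻¹ := by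
  funext i
  simp [gibbsWeight]

section Gibbs

variable [Nonempty ι]

theorem gibbsWeight_pos (E : ι → ℝ) (β : ℝ) (i : ι) : 0 < gibbsWeight E β i :=
  div_pos (Real.exp_pos _) (Finset.sum_pos (fun _ _ => Real.exp_pos _) Finset.univ_nonempty)

theorem sum_gibbsWeight (E : ι → ℝ) (β : ℝ) : ∑ i, gibbsWeight E β i = 1 := by
  simp only [gibbsWeight]
  rw [← Finset.sum_div]
  exact div_self (Finset.sum_pos (fun _ _ => Real.exp_pos _) Finset.univ_nonempty).ne'

theorem log_gibbsWeight (E : ι → ℝ) (β : ℝ) (i : ι) :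
    Real.log (gibbsWeight E β i) = -(β * E i) - Real.log (∑ j, Real.exp (-(β * E j))) := by
  rw [gibbsWeight, Real.log_div (Real.exp_pos _).ne'
    (Finset.sum_pos (fun _ _ => Real.exp_pos _) Finset.univ_nonempty).ne', Real.log_exp]

theorem sum_mul_log_gibbsWeight (E : ι → ℝ) (β : ℝ) {q : ι → ℝ} (hs : ∑ i, q i = 1) :
    ∑ i, q i * Real.log (gibbsWeight E β i) =
      -(β * ∑ i, q i * E i) - Real.log (∑ j, Real.exp (-(β * E j))) := by
  simp only [log_gibbsWeight, mul_sub, Finset.sum_sub_distrib, ← Finset.sum_mul, hs, one_mul,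
    Finset.mul_sum, ← Finset.sum_neg_distrib]
  congr 1
  exact Finset.sum_congr rfl fun i _ => by ring

theorem shannonEntropy_gibbsWeight (E : ι → ℝ) (β : ℝ) :
    shannonEntropy (gibbsWeight E β) =
      β * ∑ i, gibbsWeight E β i * E i + Real.log (∑ j, Real.exp (-(β * E j))) := by
  have h := sum_mul_log_gibbsWeight E β (sum_gibbsWeight E β)
  have h2 : shannonEntropy (gibbsWeight E β) =
      -∑ i, gibbsWeight E β i * Real.log (gibbsWeight E β i) := by
    rw [shannonEntropy, ← Finset.sum_neg_distrib]
    exact Finset.sum_congr rfl fun i _ => by rw [Real.negMulLog]; ring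
  rw [h2, h]
  ring

/-- The Gibbs variational principle, with strictness. -/
theorem shannonEntropy_sub_lt (E : ι → ℝ) (β : ℝ) {q : ι → ℝ} (hq : ∀ i, 0 ≤ q i)
    (hs : ∑ i, q i = 1) (h : q ≠ gibbsWeight E β) :
    shannonEntropy q - shannonEntropy (gibbsWeight E β) <
      β * (∑ i, q i * E i - ∑ i, gibbsWeight E β i * E i) := by
  have h1 := shannonEntropy_add_lt hq (gibbsWeight_pos E β)
    (hs.trans (sum_gibbsWeight E β).symm) h
  rw [sum_mul_log_gibbsWeight E β hs] at h1
  rw [shannonEntropy_gibbsWeight, mul_sub]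
  linarith

/-- The variational principle is applied both ways: the sum of the two inequalities says that the
colder weights have less energy, and the one at `β ≥ 0` then gives less entropy. -/
theorem gibbsWeight_lt_of_lt (E : ι → ℝ) {β γ : ℝ} (hβ : 0 ≤ β) (h : β < γ)
    (hne : gibbsWeight E β ≠ gibbsWeight E γ) :
    shannonEntropy (gibbsWeight E γ) < shannonEntropy (gibbsWeight E β) := by
  have h1 := shannonEntropy_sub_lt E γ (fun i => (gibbsWeight_pos E β i).le)
    (sum_gibbsWeight E β) hne
  have h2 := shannonEntropy_sub_lt E β (fun i => (gibbsWeight_pos E γ i).le)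
    (sum_gibbsWeight E γ) hne.symm
  have h3 : 0 < (γ - β) * (∑ i, gibbsWeight E β i * E i - ∑ i, gibbsWeight E γ i * E i) := by
    linarith
  have h4 := pos_of_mul_pos_right h3 (sub_pos.2 h).le
  have h5 := mul_nonneg hβ h4.le
  linarith

/-- At `β = 0` the energy term of the variational principle vanishes, so the uniform vector is the
only maximizer of entropy. -/
theorem gibbsWeight_zero_eq_of_le (E : ι → ℝ) {q : ι → ℝ} (hq : ∀ i, 0 ≤ q i)
    (hs : ∑ i, q i = 1) (h : shannonEntropy (gibbsWeight E 0) ≤ shannonEntropy q) :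
    q = gibbsWeight E 0 := by
  by_contra hne
  have := shannonEntropy_sub_lt E 0 hq hs hne
  linarith

theorem shannonEntropy_le_gibbsWeight_zero (E : ι → ℝ) {q : ι → ℝ} (hq : ∀ i, 0 ≤ q i)
    (hs : ∑ i, q i = 1) : shannonEntropy q ≤ shannonEntropy (gibbsWeight E 0) := by
  by_contra! h
  rw [gibbsWeight_zero_eq_of_le E hq hs h.le] at h
  exact lt_irrefl _ h

theorem continuous_gibbsWeight (E : ι → ℝ) : Continuous (gibbsWeight E) := by
  refine continuous_pi fun i => ?_
  unfold gibbsWeight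
  exact Continuous.div (by fun_prop) (by fun_prop) fun β =>
    (Finset.sum_pos (fun _ _ => Real.exp_pos _) Finset.univ_nonempty).ne'

theorem gibbsWeight_ne (E : ι → ℝ) {β γ : ℝ} (h : β ≠ γ) {i j : ι} (hij : E i ≠ E j) :
    gibbsWeight E β ≠ gibbsWeight E γ := by
  intro he
  have hi := congrArg Real.log (congrFun he i)
  have hj := congrArg Real.log (congrFun he j)
  rw [log_gibbsWeight, log_gibbsWeight] at hi hj
  have : (β - γ) * (E i - E j) = 0 := by linarith
  rcases mul_eq_zero.1 this with h1 | h1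
  · exact h (sub_eq_zero.1 h1)
  · exact hij (sub_eq_zero.1 h1)

theorem tendsto_gibbsWeight [DecidableEq ι] (E : ι → ℝ) {i₀ : ι} (h : ∀ j, j ≠ i₀ → E i₀ < E j) :
    Tendsto (gibbsWeight E) atTop (𝓝 (Pi.single i₀ 1)) := by
  have hj : ∀ j, j ≠ i₀ → Tendsto (fun β => gibbsWeight E β j) atTop (𝓝 0) := by
    intro j hj
    have hle : ∀ β, gibbsWeight E β j ≤ Real.exp (-((E j - E i₀) * β)) := by
      intro β
      have h1 : gibbsWeight E β j ≤ Real.exp (-(β * E j)) / Real.exp (-(β * E i₀)) :=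
        div_le_div_of_nonneg_left (Real.exp_pos _).le (Real.exp_pos _)
          (Finset.single_le_sum (f := fun k => Real.exp (-(β * E k)))
            (fun k _ => (Real.exp_pos _).le) (Finset.mem_univ i₀))
      rw [← Real.exp_sub] at h1
      convert h1 using 2
      ring
    refine squeeze_zero (fun β => (gibbsWeight_pos E β j).le) hle ?_
    exact Real.tendsto_exp_neg_atTop_nhds_zero.comp
      (tendsto_id.const_mul_atTop (sub_pos.2 (h j hj)))
  refine tendsto_pi_nhds.2 fun j => ?_
  by_cases hji : j = i₀
  · subst hji
    have h1 : (fun β => gibbsWeight E β j) =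
        fun β => 1 - ∑ k ∈ Finset.univ.erase j, gibbsWeight E β k := by
      funext β
      rw [← sum_gibbsWeight E β, ← Finset.add_sum_erase _ _ (Finset.mem_univ j)]
      ring
    rw [h1, Pi.single_eq_same]
    have h2 := tendsto_finsetSum (Finset.univ.erase j)
      (fun k hk => hj k (Finset.ne_of_mem_erase hk))
    simpa using h2.const_sub 1
  · rw [Pi.single_eq_of_ne hji]
    exact hj j hji

end Gibbs

theorem continuous_shannonEntropy : Continuous (shannonEntropy : (ι → ℝ) → ℝ) := by
  unfold shannonEntropy
  exact continuous_finsetSum _ fun i _ => Real.continuous_negMulLog.comp (continuous_apply i)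

theorem shannonEntropy_single [DecidableEq ι] (i₀ : ι) :
    shannonEntropy (Pi.single i₀ 1 : ι → ℝ) = 0 := by
  refine Finset.sum_eq_zero fun i _ => ?_
  by_cases h : i = i₀
  · subst h; simp
  · simp [h]

/-! ### Typical sequences and source coding -/

section Product

theorem sum_prod_eq_one (n : ℕ) {p : ι → ℝ} (hs : ∑ i, p i = 1) :
    ∑ f : Fin n → ι, ∏ k, p (f k) = 1 := by
  classical
  have := Finset.prod_univ_sum (fun _ : Fin n => (Finset.univ : Finset ι)) (fun _ i => p i)
  rw [Fintype.piFinset_univ] at this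
  rw [← this]
  simp [hs]

theorem sum_fin_succ_fun {n : ℕ} (F : (Fin (n + 1) → ι) → ℝ) :
    ∑ f, F f = ∑ a, ∑ f : Fin n → ι, F (Fin.cons a f) := by
  rw [← (Fin.consEquiv fun _ : Fin (n + 1) => ι).sum_comp, Fintype.sum_prod_type]
  rfl

theorem sum_prod_mul_sum (n : ℕ) {p : ι → ℝ} (hs : ∑ i, p i = 1) (Y : ι → ℝ) :
    ∑ f : Fin n → ι, (∏ k, p (f k)) * ∑ k, Y (f k) = n * ∑ i, p i * Y i := by
  induction n with
  | zero => simp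
  | succ n ih =>
    rw [sum_fin_succ_fun]
    simp only [Fin.prod_univ_succ, Fin.sum_univ_succ, Fin.cons_zero, Fin.cons_succ]
    have : ∀ a (f : Fin n → ι), p a * (∏ k, p (f k)) * (Y a + ∑ k, Y (f k)) =
        p a * Y a * (∏ k, p (f k)) + p a * ((∏ k, p (f k)) * ∑ k, Y (f k)) :=
      fun a f => by ring
    simp only [this, Finset.sum_add_distrib, ← Finset.mul_sum, ih, sum_prod_eq_one n hs, mul_one,
      ← Finset.sum_mul, hs]
    push_cast
    ring

/-- Variances of independent variables add: the cross term has the factor `∑ p i * Y i = 0`. -/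
theorem sum_prod_mul_sum_sq (n : ℕ) {p : ι → ℝ} (hs : ∑ i, p i = 1) {Y : ι → ℝ}
    (hY : ∑ i, p i * Y i = 0) :
    ∑ f : Fin n → ι, (∏ k, p (f k)) * (∑ k, Y (f k)) ^ 2 = n * ∑ i, p i * Y i ^ 2 := by
  induction n with
  | zero => simp
  | succ n ih =>
    rw [sum_fin_succ_fun]
    simp only [Fin.prod_univ_succ, Fin.sum_univ_succ, Fin.cons_zero, Fin.cons_succ]
    have : ∀ a (f : Fin n → ι), p a * (∏ k, p (f k)) * (Y a + ∑ k, Y (f k)) ^ 2 =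
        p a * Y a ^ 2 * (∏ k, p (f k)) + 2 * (p a * Y a) * ((∏ k, p (f k)) * ∑ k, Y (f k)) +
          p a * ((∏ k, p (f k)) * (∑ k, Y (f k)) ^ 2) :=
      fun a f => by ring
    simp only [this, Finset.sum_add_distrib, ← Finset.mul_sum, ih, sum_prod_eq_one n hs, mul_one,
      ← Finset.sum_mul, hs, hY]
    push_cast
    ring

/-- Chebyshev's inequality for sums of independent identically distributed variables. -/
theorem sum_prod_filter_le {n : ℕ} (hn : 0 < n) {p : ι → ℝ} (hp : ∀ i, 0 ≤ p i) (hs : ∑ i, p i = 1)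
    (X : ι → ℝ) {δ : ℝ} (hδ : 0 < δ) :
    ∑ f : Fin n → ι with n * δ ≤ |∑ k, X (f k) - n * ∑ i, p i * X i|, ∏ k, p (f k) ≤
      (∑ i, p i * (X i - ∑ j, p j * X j) ^ 2) / δ ^ 2 / n := by
  set μ := ∑ i, p i * X i with hμ
  have hY : ∑ i, p i * (X i - μ) = 0 := by
    simp only [mul_sub, Finset.sum_sub_distrib, ← Finset.sum_mul, hs, one_mul, hμ, sub_self]
  have h1 := sum_prod_mul_sum_sq n hs hY
  have hn' : (0 : ℝ) < n := by exact_mod_cast hn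
  have h2 : (∑ f : Fin n → ι with n * δ ≤ |∑ k, X (f k) - n * μ|, ∏ k, p (f k)) * (n * δ) ^ 2 ≤
      n * ∑ i, p i * (X i - μ) ^ 2 := by
    rw [← h1, Finset.sum_mul]
    refine (Finset.sum_le_sum (g := fun f : Fin n → ι =>
      (∏ k, p (f k)) * (∑ k, (X (f k) - μ)) ^ 2) fun f hf => ?_).trans
      (Finset.sum_le_sum_of_subset_of_nonneg (Finset.filter_subset _ _) fun f _ _ =>
        mul_nonneg (Finset.prod_nonneg fun k _ => hp _) (sq_nonneg _))
    refine mul_le_mul_of_nonneg_left ?_ (Finset.prod_nonneg fun k _ => hp _)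
    have h3 := (Finset.mem_filter.1 hf).2
    have h4 : ∑ k, (X (f k) - μ) = ∑ k, X (f k) - n * μ := by
      simp [Finset.sum_sub_distrib]
    rw [h4, ← sq_abs (∑ k, X (f k) - n * μ)]
    exact pow_le_pow_left₀ (by positivity) h3 2
  rw [div_div, le_div_iff₀ (by positivity)]
  have h5 : (∑ f : Fin n → ι with n * δ ≤ |∑ k, X (f k) - n * μ|, ∏ k, p (f k)) * (δ ^ 2 * n) * n
      ≤ (∑ i, p i * (X i - μ) ^ 2) * n := by linarith
  exact le_of_mul_le_mul_right h5 hn'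

theorem exists_perm_mapsTo {α : Type*} [Fintype α] [DecidableEq α] {T G : Finset α}
    (h : T.card ≤ G.card) : ∃ π : Equiv.Perm α, ∀ x ∈ T, π x ∈ G := by
  obtain ⟨G', hG', hc⟩ := Finset.exists_subset_card_eq h
  refine ⟨(Finset.equivOfCardEq hc.symm).extendSubtype, fun x hx => hG' ?_⟩
  exact Equiv.extendSubtype_mem (Finset.equivOfCardEq hc.symm) x hx

/-- At most `exp c` points have probability at least `exp (-c)`. -/
theorem card_filter_le {α : Type*} [Fintype α] {q : α → ℝ} (hq : ∀ f, 0 ≤ q f)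
    (hs : ∑ f, q f = 1) (c : ℝ) :
    ((Finset.univ.filter fun f => Real.exp (-c) ≤ q f).card : ℝ) ≤ Real.exp c := by
  have h : ((Finset.univ.filter fun f => Real.exp (-c) ≤ q f).card : ℝ) * Real.exp (-c) ≤ 1 := by
    rw [← nsmul_eq_mul, ← hs]
    exact (Finset.card_nsmul_le_sum _ q _ fun f hf => (Finset.mem_filter.1 hf).2).trans
      (Finset.sum_le_sum_of_subset_of_nonneg (Finset.filter_subset _ _) fun f _ _ => hq f)
  have h2 := mul_le_mul_of_nonneg_right h (Real.exp_pos c).le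
  rwa [mul_assoc, ← Real.exp_add, neg_add_cancel, Real.exp_zero, mul_one, one_mul] at h2

/-- Source coding: the sequences that are not likely carry little probability. -/
theorem sum_unlikely_le {n : ℕ} (hn : 0 < n) {p : ι → ℝ} (hp : ∀ i, 0 ≤ p i)
    (hs : ∑ i, p i = 1) {δ : ℝ} (hδ : 0 < δ) :
    ∑ f : Fin n → ι with ¬ Real.exp (-(n * (shannonEntropy p + δ))) ≤ ∏ k, p (f k),
      ∏ k, p (f k) ≤
      (∑ i, p i * (-Real.log (p i) - shannonEntropy p) ^ 2) / δ ^ 2 / n := by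
  have hS : shannonEntropy p = ∑ i, p i * (-Real.log (p i)) :=
    Finset.sum_congr rfl fun i _ => by rw [Real.negMulLog]; ring
  have h := sum_prod_filter_le hn hp hs (fun i => -Real.log (p i)) hδ
  rw [← hS] at h
  refine le_trans ?_ h
  rw [Finset.sum_filter, Finset.sum_filter]
  refine Finset.sum_le_sum fun f _ => ?_
  have h0 : 0 ≤ ∏ k, p (f k) := Finset.prod_nonneg fun k _ => hp _
  split_ifs with h1 h2 h2
  · exact h0
  · exact le_rfl
  · exact le_rfl
  -- Sequences of probability zero contribute nothing, so all factors may be taken nonzero and the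
  -- logarithm of the product splits.
  · by_contra! h3
    refine h2 ?_
    have h4 : ∀ k, p (f k) ≠ 0 := fun k => Finset.prod_ne_zero_iff.1 h3.ne' k (Finset.mem_univ k)
    have h5 := Real.log_lt_log h3 (not_le.1 h1)
    rw [Real.log_exp, Real.log_prod fun k _ => h4 k] at h5
    refine le_trans ?_ (le_abs_self _)
    rw [Finset.sum_neg_distrib]
    linarith

/-- The sequences whose mean energy is within `δ` of the thermal one number at least
`exp (n (s - β δ)) / 2`, where `s` is the entropy of the thermal weights. -/
theorem le_card_thermal [Nonempty ι] {n : ℕ} (hn : 0 < n) (E : ι → ℝ) {β δ : ℝ} (hβ : 0 ≤ β)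
    (hδ : 0 < δ)
    (hV : (∑ i, gibbsWeight E β i * (E i - ∑ j, gibbsWeight E β j * E j) ^ 2) / δ ^ 2 / n ≤
      1 / 2) :
    Real.exp (n * (shannonEntropy (gibbsWeight E β) - β * δ)) / 2 ≤
      ((Finset.univ.filter fun f : Fin n → ι =>
        ¬ n * δ ≤ |∑ k, E (f k) - n * ∑ i, gibbsWeight E β i * E i|).card : ℝ) := by
  set g := gibbsWeight E β with hg
  set c := n * (shannonEntropy g - β * δ) with hc
  set e := ∑ i, g i * E i with he
  have h1 := sum_prod_filter_le hn (fun i => (gibbsWeight_pos E β i).le) (sum_gibbsWeight E β) E hδ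
  have h2 := Finset.sum_filter_add_sum_filter_not (Finset.univ : Finset (Fin n → ι))
    (fun f => n * δ ≤ |∑ k, E (f k) - n * e|) (fun f => ∏ k, g (f k))
  rw [sum_prod_eq_one n (sum_gibbsWeight E β)] at h2
  -- A sequence of energy at least `n (e - δ)` has thermal probability at most `exp (-c)`, so a set
  -- of probability at least `1 / 2` needs at least `exp c / 2` of them.
  have h3 : ∑ f : Fin n → ι with ¬ n * δ ≤ |∑ k, E (f k) - n * e|, ∏ k, g (f k) ≤
      (Finset.univ.filter fun f : Fin n → ι =>
        ¬ n * δ ≤ |∑ k, E (f k) - n * e|).card • Real.exp (-c) := by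
    refine Finset.sum_le_card_nsmul _ _ _ fun f hf => ?_
    have h4 := not_le.1 (Finset.mem_filter.1 hf).2
    have h5 := (abs_lt.1 h4).1
    have hpos : 0 < ∏ k, g (f k) := Finset.prod_pos fun k _ => gibbsWeight_pos E β _
    rw [← Real.log_le_iff_le_exp hpos, Real.log_prod fun k _ => (gibbsWeight_pos E β _).ne']
    simp only [log_gibbsWeight, Finset.sum_sub_distrib, Finset.sum_neg_distrib,
      ← Finset.mul_sum, Finset.sum_const, Finset.card_univ, Fintype.card_fin, nsmul_eq_mul]
    rw [hc, hg, shannonEntropy_gibbsWeight, ← hg, ← he]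
    have h6 := mul_le_mul_of_nonneg_left h5.le hβ
    linarith
  rw [nsmul_eq_mul, Real.exp_neg, ← div_eq_mul_inv, le_div_iff₀ (Real.exp_pos c)] at h3
  have h7 : (1 : ℝ) / 2 ≤
      ∑ f : Fin n → ι with ¬ n * δ ≤ |∑ k, E (f k) - n * e|, ∏ k, g (f k) := by
    linarith [h1.trans hV]
  have := mul_le_mul_of_nonneg_right h7 (Real.exp_pos c).le
  linarith

/-- If the thermal weights at `β` have more entropy than `p`, then some relabelling of the
sequences brings the mean energy of `p ⊗ ⋯ ⊗ p` down to nearly the thermal energy. -/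
theorem eventually_exists_perm [Nonempty ι] [DecidableEq ι] (E : ι → ℝ) {p : ι → ℝ}
    (hp : ∀ i, 0 ≤ p i) (hs : ∑ i, p i = 1) {β ε : ℝ} (hβ : 0 ≤ β) (hε : 0 < ε)
    (hS : shannonEntropy p < shannonEntropy (gibbsWeight E β)) :
    ∀ᶠ n : ℕ in atTop, ∃ π : Equiv.Perm (Fin n → ι),
      ∑ f : Fin n → ι, (∏ k, p (f k)) * ∑ k, E (π f k) ≤
        n * (∑ i, gibbsWeight E β i * E i + ε) := by
  set e := ∑ i, gibbsWeight E β i * E i with he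
  set gap := shannonEntropy (gibbsWeight E β) - shannonEntropy p with hgap
  have hgap0 : 0 < gap := sub_pos.2 hS
  -- The widths of the two typical sets cost `(1 + β) δ` of the entropy gap; the other half of the
  -- gap absorbs the factor 2 in the count. Likewise half of `ε` pays for the window and half for
  -- the unlikely sequences.
  obtain ⟨δ, hδ, hδε, hδgap⟩ : ∃ δ : ℝ, 0 < δ ∧ δ ≤ ε / 2 ∧ (1 + β) * δ ≤ gap / 2 := by
    refine ⟨min (ε / 2) (gap / 2 / (1 + β)), by positivity, min_le_left _ _, ?_⟩
    have := min_le_right (ε / 2) (gap / 2 / (1 + β))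
    rwa [le_div_iff₀ (by positivity), mul_comm] at this
  obtain ⟨M, hM0, hM⟩ : ∃ M : ℝ, 0 ≤ M ∧ ∀ i, |E i| ≤ M :=
    ⟨∑ i, |E i|, Finset.sum_nonneg fun i _ => abs_nonneg _, fun i =>
      Finset.single_le_sum (f := fun i => |E i|) (fun i _ => abs_nonneg _) (Finset.mem_univ i)⟩
  have heM : -M ≤ e := by
    have : ∑ i, gibbsWeight E β i * (-M) ≤ e := Finset.sum_le_sum fun i _ =>
      mul_le_mul_of_nonneg_left (abs_le.1 (hM i)).1 (gibbsWeight_pos E β i).le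
    rwa [← Finset.sum_mul, sum_gibbsWeight, one_mul] at this
  set V₁ := (∑ i, gibbsWeight E β i * (E i - e) ^ 2) / δ ^ 2 with hV₁
  set V₂ := (∑ i, p i * (-Real.log (p i) - shannonEntropy p) ^ 2) / δ ^ 2 with hV₂
  have hlim : ∀ C : ℝ, Tendsto (fun n : ℕ => C / n) atTop (𝓝 0) :=
    fun C => tendsto_const_div_atTop_nhds_zero_nat C
  filter_upwards [eventually_gt_atTop 0,
    (hlim V₁).eventually_le_const (by norm_num : (0 : ℝ) < 1 / 2),
    (hlim (2 * M * V₂)).eventually_le_const (half_pos hε),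
    (hlim (Real.log 2)).eventually_le_const (half_pos hgap0)] with n hn h₁ h₂ h₃
  have hn' : (0 : ℝ) < n := by exact_mod_cast hn
  set q : (Fin n → ι) → ℝ := fun f => ∏ k, p (f k) with hq
  have hq0 : ∀ f, 0 ≤ q f := fun f => Finset.prod_nonneg fun k _ => hp _
  have hq1 : ∑ f, q f = 1 := sum_prod_eq_one n hs
  set T := Finset.univ.filter fun f : Fin n → ι =>
    Real.exp (-(n * (shannonEntropy p + δ))) ≤ q f with hT
  set G := Finset.univ.filter fun f : Fin n → ι => ¬ n * δ ≤ |∑ k, E (f k) - n * e| with hG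
  have hcard : T.card ≤ G.card := by
    have hTc : (T.card : ℝ) ≤ _ := card_filter_le hq0 hq1 (n * (shannonEntropy p + δ))
    have hGc : _ ≤ (G.card : ℝ) := le_card_thermal hn E hβ hδ h₁
    have hmid : Real.exp (n * (shannonEntropy p + δ)) ≤
        Real.exp (n * (shannonEntropy (gibbsWeight E β) - β * δ)) / 2 := by
      rw [le_div_iff₀ two_pos, ← Real.exp_log (two_pos : (0 : ℝ) < 2), ← Real.exp_add,
        Real.exp_le_exp]
      rw [div_le_iff₀ hn'] at h₃
      have : n * ((1 + β) * δ) ≤ n * (gap / 2) := mul_le_mul_of_nonneg_left hδgap hn'.le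
      rw [hgap] at this h₃
      linarith
    exact_mod_cast hTc.trans (hmid.trans hGc)
  obtain ⟨π, hπ⟩ := exists_perm_mapsTo hcard
  refine ⟨π, ?_⟩
  -- Since `e ≥ -M`, an unlikely sequence exceeds the target energy `n (e + δ)` by at most `2 M n`,
  -- wherever `π` sends it.
  have hbound : ∀ f, q f * ∑ k, E (π f k) ≤
      q f * (n * (e + δ)) + (if ¬ Real.exp (-(n * (shannonEntropy p + δ))) ≤ q f
        then q f else 0) * (2 * M * n) := by
    intro f
    by_cases hf : Real.exp (-(n * (shannonEntropy p + δ))) ≤ q f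
    · have h4 := hπ f (Finset.mem_filter.2 ⟨Finset.mem_univ f, hf⟩)
      have h5 := (abs_lt.1 (not_le.1 (Finset.mem_filter.1 h4).2)).2
      rw [if_neg (not_not.2 hf), zero_mul, add_zero]
      exact mul_le_mul_of_nonneg_left (by linarith) (hq0 f)
    · rw [if_pos hf, ← mul_add]
      refine mul_le_mul_of_nonneg_left ?_ (hq0 f)
      have h4 : ∑ k, E (π f k) ≤ n * M := by
        have := Finset.sum_le_card_nsmul (Finset.univ : Finset (Fin n)) (fun k => E (π f k)) M
          fun k _ => (abs_le.1 (hM _)).2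
        simpa using this
      have h5 : 0 ≤ n * (M + e + δ) := mul_nonneg hn'.le (by linarith)
      linarith
  have h6 := Finset.sum_le_sum fun f (_ : f ∈ Finset.univ) => hbound f
  rw [Finset.sum_add_distrib, ← Finset.sum_mul, ← Finset.sum_mul, hq1, one_mul,
    ← Finset.sum_filter] at h6
  have h7 : ∑ f : Fin n → ι with ¬ Real.exp (-(n * (shannonEntropy p + δ))) ≤ q f, q f ≤ V₂ / n :=
    sum_unlikely_le hn hp hs hδ
  have h8 := mul_le_mul_of_nonneg_right h7 (show 0 ≤ 2 * M * n by positivity)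
  have h9 : V₂ / n * (2 * M * n) = n * (2 * M * V₂ / n) := by field_simp
  have h10 := mul_le_mul_of_nonneg_left h₂ hn'.le
  have h11 := mul_le_mul_of_nonneg_left hδε hn'.le
  linarith

end Product

/-! ### Additivity over copies, and the Gibbs vector of given entropy -/

theorem shannonEntropy_prod (n : ℕ) {p : ι → ℝ} (hs : ∑ i, p i = 1) :
    shannonEntropy (fun f : Fin n → ι => ∏ k, p (f k)) = n * shannonEntropy p := by
  have hS : shannonEntropy p = ∑ i, p i * (-Real.log (p i)) :=
    Finset.sum_congr rfl fun i _ => by rw [Real.negMulLog]; ring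
  rw [hS, ← sum_prod_mul_sum n hs, shannonEntropy]
  refine Finset.sum_congr rfl fun f _ => ?_
  by_cases h : ∏ k, p (f k) = 0
  · simp [h]
  · rw [Real.negMulLog, Real.log_prod fun k _ => Finset.prod_ne_zero_iff.1 h k (Finset.mem_univ k),
      Finset.sum_neg_distrib]
    ring

theorem sum_exp_sum (n : ℕ) (E : ι → ℝ) (β : ℝ) :
    ∑ f : Fin n → ι, Real.exp (-(β * ∑ k, E (f k))) = (∑ i, Real.exp (-(β * E i))) ^ n := by
  classical
  have h := Finset.prod_univ_sum (fun _ : Fin n => (Finset.univ : Finset ι))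
    (fun _ i => Real.exp (-(β * E i)))
  rw [Fintype.piFinset_univ, Finset.prod_const, Finset.card_univ, Fintype.card_fin] at h
  rw [h]
  refine Finset.sum_congr rfl fun f _ => ?_
  rw [← Real.exp_sum, Finset.sum_neg_distrib, Finset.mul_sum]

theorem shannonEntropy_gibbsWeight_pos [Nonempty ι] {E : ι → ℝ} {i j : ι} (hij : E i ≠ E j)
    {β : ℝ} (hβ : 0 ≤ β) : 0 < shannonEntropy (gibbsWeight E β) :=
  (shannonEntropy_nonneg (fun i => (gibbsWeight_pos E (β + 1) i).le)
    (sum_gibbsWeight E (β + 1))).trans_lt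
    (gibbsWeight_lt_of_lt E hβ (lt_add_one β) (gibbsWeight_ne E (lt_add_one β).ne hij))

/-- The spectra of the Gibbs states at inverse temperatures in `[0, ∞]`, with `i₀` the ground
level. -/
def IsGibbsVector [DecidableEq ι] (E : ι → ℝ) (i₀ : ι) (v : ι → ℝ) : Prop :=
  (∃ β : ℝ, 0 ≤ β ∧ v = gibbsWeight E β) ∨ v = Pi.single i₀ 1

/-- Only the weights are determined, not the temperature: for constant `E` all temperatures give the
same weights. -/
theorem gibbsWeight_eq_of_entropy_eq [Nonempty ι] {E : ι → ℝ} {β γ : ℝ} (hβ : 0 ≤ β) (hγ : 0 ≤ γ)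
    (h : shannonEntropy (gibbsWeight E β) = shannonEntropy (gibbsWeight E γ)) :
    gibbsWeight E β = gibbsWeight E γ := by
  by_contra hne
  rcases lt_trichotomy β γ with h1 | h1 | h1
  · exact (gibbsWeight_lt_of_lt E hβ h1 hne).ne h.symm
  · exact hne (h1 ▸ rfl)
  · exact (gibbsWeight_lt_of_lt E hγ h1 (Ne.symm hne)).ne h

theorem eq_of_sum_eq_one_of_subsingleton [Subsingleton ι] {v w : ι → ℝ} (hv : ∑ i, v i = 1)
    (hw : ∑ i, w i = 1) : v = w := by
  funext i
  rw [Fintype.sum_subsingleton _ i] at hv hw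
  rw [hv, hw]

/-- At finite temperature, zero entropy is possible only for a single level. -/
theorem gibbsWeight_eq_single [Nonempty ι] [DecidableEq ι] {E : ι → ℝ}
    (hE : Function.Injective E) (i₀ : ι) {β : ℝ} (hβ : 0 ≤ β)
    (h : shannonEntropy (gibbsWeight E β) = 0) : gibbsWeight E β = Pi.single i₀ 1 := by
  rcases subsingleton_or_nontrivial ι with hι | hι
  · exact eq_of_sum_eq_one_of_subsingleton (sum_gibbsWeight E β) (by simp)
  · obtain ⟨i, j, hij⟩ := exists_pair_ne ι
    exact absurd h (shannonEntropy_gibbsWeight_pos (hE.ne hij) hβ).ne'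

theorem IsGibbsVector.eq_of_entropy_eq [Nonempty ι] [DecidableEq ι] {E : ι → ℝ}
    (hE : Function.Injective E) {i₀ : ι} {v w : ι → ℝ} (hv : IsGibbsVector E i₀ v)
    (hw : IsGibbsVector E i₀ w) (h : shannonEntropy v = shannonEntropy w) : v = w := by
  rcases hv with ⟨β, hβ, rfl⟩ | rfl <;> rcases hw with ⟨γ, hγ, rfl⟩ | rfl
  · exact gibbsWeight_eq_of_entropy_eq hβ hγ h
  · exact gibbsWeight_eq_single hE i₀ hβ (h.trans (shannonEntropy_single i₀))
  · exact (gibbsWeight_eq_single hE i₀ hγ (h.symm.trans (shannonEntropy_single i₀))).symm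
  · rfl

/-- Entropy falls continuously from its maximum at `β = 0` to the limit 0. The value 0 is taken from
the ground-state vector, since finite `β` may not reach it. -/
theorem exists_isGibbsVector [Nonempty ι] [DecidableEq ι] {E : ι → ℝ} {i₀ : ι}
    (h₀ : ∀ j, j ≠ i₀ → E i₀ < E j) {p : ι → ℝ} (hp : ∀ i, 0 ≤ p i) (hs : ∑ i, p i = 1) :
    ∃ v, IsGibbsVector E i₀ v ∧ shannonEntropy v = shannonEntropy p := by
  rcases (shannonEntropy_nonneg hp hs).eq_or_lt with h | h
  · exact ⟨_, Or.inr rfl, (shannonEntropy_single i₀).trans h⟩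
  · have hlim : Tendsto (fun β => shannonEntropy (gibbsWeight E β)) atTop (𝓝 0) := by
      have := (continuous_shannonEntropy.tendsto _).comp (tendsto_gibbsWeight E h₀)
      rwa [shannonEntropy_single] at this
    obtain ⟨γ, hγ, hγ0⟩ := ((hlim.eventually_lt_const h).and (eventually_ge_atTop 0)).exists
    have hc : ContinuousOn (fun β => shannonEntropy (gibbsWeight E β)) (Set.Icc 0 γ) :=
      (continuous_shannonEntropy.comp (continuous_gibbsWeight E)).continuousOn
    obtain ⟨β, hβ, hβe⟩ := intermediate_value_Icc' hγ0 hc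
      ⟨hγ.le, shannonEntropy_le_gibbsWeight_zero E hp hs⟩
    exact ⟨_, Or.inl ⟨β, hβ.1, rfl⟩, hβe⟩

/-- Slightly hotter than the Gibbs vector with the entropy of `p` there are thermal weights with
more entropy than `p` and only slightly more energy. -/
theorem IsGibbsVector.exists_hotter [Nonempty ι] [DecidableEq ι] {E : ι → ℝ}
    (hE : Function.Injective E) {i₀ : ι} (h₀ : ∀ j, j ≠ i₀ → E i₀ < E j) {v p : ι → ℝ}
    (hv : IsGibbsVector E i₀ v) (hs : ∑ i, p i = 1) (h : shannonEntropy v = shannonEntropy p)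
    (hp0 : p ≠ gibbsWeight E 0) (hv0 : v ≠ gibbsWeight E 0) {ε : ℝ} (hε : 0 < ε) :
    ∃ β : ℝ, 0 ≤ β ∧ shannonEntropy p < shannonEntropy (gibbsWeight E β) ∧
      ∑ i, gibbsWeight E β i * E i < ∑ i, v i * E i + ε := by
  have hι : Nontrivial ι := by
    by_contra hι
    rw [not_nontrivial_iff_subsingleton] at hι
    exact hp0 (eq_of_sum_eq_one_of_subsingleton hs (sum_gibbsWeight E 0))
  obtain ⟨i, j, hij⟩ := exists_pair_ne ι
  have hc : Continuous fun w : ι → ℝ => ∑ i, w i * E i := by fun_prop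
  rw [← h]
  rcases hv with ⟨β, hβ, rfl⟩ | rfl
  -- Excluding the uniform vector leaves room for a hotter `γ` in `(0, β)`.
  · have hβ' : 0 < β := hβ.lt_of_ne fun h0 => hv0 (h0 ▸ rfl)
    have hlim : Tendsto (fun γ => ∑ i, gibbsWeight E γ i * E i) (𝓝[<] β)
        (𝓝 (∑ i, gibbsWeight E β i * E i)) :=
      ((hc.comp (continuous_gibbsWeight E)).tendsto β).mono_left nhdsWithin_le_nhds
    obtain ⟨γ, h1, h2⟩ := ((hlim.eventually_lt_const (lt_add_of_pos_right _ hε)).and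
      (Ioo_mem_nhdsLT hβ')).exists
    exact ⟨γ, h2.1.le, gibbsWeight_lt_of_lt E h2.1.le h2.2
      (gibbsWeight_ne E h2.2.ne (hE.ne hij)), h1⟩
  · have hlim := (hc.tendsto _).comp (tendsto_gibbsWeight E h₀)
    obtain ⟨γ, h1, h2⟩ := ((hlim.eventually_lt_const (lt_add_of_pos_right _ hε)).and
      (eventually_ge_atTop 0)).exists
    refine ⟨γ, h2, ?_, h1⟩
    rw [shannonEntropy_single]
    exact shannonEntropy_gibbsWeight_pos (hE.ne hij) h2

end Classical

/-! ### Energy on the unitary orbit -/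

section Mixing

theorem sum_sum_normSq_mul (X : Matrix.unitaryGroup m ℂ) (q : m → ℝ) :
    ∑ i, ∑ j, Complex.normSq (X i j) * q j = ∑ j, q j := by
  rw [Finset.sum_comm]
  simp only [← Finset.sum_mul, sum_normSq_col, one_mul]

/-- The energy of a state whose spectrum is `q` obeys the Gibbs variational inequality. -/
theorem shannonEntropy_le_mixed_energy [Nonempty m] (X : Matrix.unitaryGroup m ℂ) {q : m → ℝ}
    (hq : ∀ j, 0 ≤ q j) (hs : ∑ j, q j = 1) (E : m → ℝ) (β : ℝ) :
    shannonEntropy q ≤ β * (∑ i, ∑ j, Complex.normSq (X i j) * q j * E i) +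
      Real.log (∑ i, Real.exp (-(β * E i))) := by
  set L := Real.log (∑ i, Real.exp (-(β * E i))) with hL
  -- Averaging the scalar Gibbs inequality for each pair `q j`, `g i` with the doubly stochastic
  -- weights `|X i j|²` avoids any use of the entropy of the mixed vector.
  have h1 : ∑ i, ∑ j, Complex.normSq (X i j) * (Real.negMulLog (q j) +
      q j * Real.log (gibbsWeight E β i)) ≤
      ∑ i, ∑ j, Complex.normSq (X i j) * (gibbsWeight E β i - q j) :=
    Finset.sum_le_sum fun i _ => Finset.sum_le_sum fun j _ => mul_le_mul_of_nonneg_left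
      (negMulLog_add_mul_log_le (hq j) (gibbsWeight_pos E β i)) (Complex.normSq_nonneg _)
  have h2 : ∑ i, ∑ j, Complex.normSq (X i j) * (gibbsWeight E β i - q j) = 0 := by
    simp only [mul_sub, Finset.sum_sub_distrib, ← Finset.sum_mul, sum_normSq_row, one_mul,
      sum_gibbsWeight, sum_sum_normSq_mul, hs, sub_self]
  have h3 : ∀ i j, Complex.normSq (X i j) * (Real.negMulLog (q j) +
      q j * Real.log (gibbsWeight E β i)) = Complex.normSq (X i j) * Real.negMulLog (q j) -
        β * (Complex.normSq (X i j) * q j * E i) - Complex.normSq (X i j) * q j * L :=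
    fun i j => by rw [log_gibbsWeight, ← hL]; ring
  simp only [h3, Finset.sum_sub_distrib, ← Finset.mul_sum, ← Finset.sum_mul, sum_sum_normSq_mul,
    hs, one_mul, h2] at h1
  simp only [shannonEntropy, ← Finset.sum_mul]
  linarith

theorem le_mixed_energy (X : Matrix.unitaryGroup m ℂ) {q : m → ℝ} (hq : ∀ j, 0 ≤ q j)
    (hs : ∑ j, q j = 1) {E : m → ℝ} {c : ℝ} (hc : ∀ i, c ≤ E i) :
    c ≤ ∑ i, ∑ j, Complex.normSq (X i j) * q j * E i := by
  have h : ∑ i, ∑ j, Complex.normSq (X i j) * q j * c ≤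
      ∑ i, ∑ j, Complex.normSq (X i j) * q j * E i :=
    Finset.sum_le_sum fun i _ => Finset.sum_le_sum fun j _ => mul_le_mul_of_nonneg_left (hc i)
      (mul_nonneg (Complex.normSq_nonneg _) (hq j))
  simpa only [← Finset.sum_mul, sum_sum_normSq_mul, hs, one_mul] using h

theorem mixed_energy_const (X : Matrix.unitaryGroup m ℂ) (c : ℝ) (E : m → ℝ) :
    ∑ i, ∑ j, Complex.normSq (X i j) * c * E i = ∑ i, c * E i := by
  simp only [← Finset.sum_mul, sum_normSq_row, one_mul]

/-- The inverse appears because `permUnitary σ` has its nonzero entries at `(i, σ i)`; with `σ =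
π⁻¹`, column `j` meets row `π j`. -/
theorem mixed_energy_permUnitary (π : Equiv.Perm m) (q E : m → ℝ) :
    ∑ i, ∑ j, Complex.normSq (permUnitary π⁻¹ i j) * q j * E i = ∑ j, q j * E (π j) := by
  simp only [normSq_permUnitary, ite_mul, one_mul, zero_mul, Finset.sum_ite_eq, Finset.mem_univ,
    if_true]
  rw [← Equiv.sum_comp π]
  simp

/-- The least energy on the unitary orbit of a state. -/
def minEnergy (ρ H : Matrix m m ℂ) : ℝ :=
  ⨅ U : Matrix.unitaryGroup m ℂ,
    energy ((U : Matrix m m ℂ) * ρ * (U : Matrix m m ℂ).conjTranspose) H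

theorem le_minEnergy_conjDiag (V W : Matrix.unitaryGroup m ℂ) {q E : m → ℝ} {c : ℝ}
    (h : ∀ X : Matrix.unitaryGroup m ℂ,
      c ≤ ∑ i, ∑ j, Complex.normSq (X i j) * q j * E i) :
    c ≤ minEnergy (conjDiag V q) (conjDiag W E) :=
  le_ciInf fun U => by
    rw [energy_conj_conjDiag]
    exact h _

theorem minEnergy_conjDiag_le (V W X : Matrix.unitaryGroup m ℂ) (q E : m → ℝ) :
    minEnergy (conjDiag V q) (conjDiag W E) ≤
      ∑ i, ∑ j, Complex.normSq (X i j) * q j * E i := by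
  obtain ⟨_, hle, heq⟩ := exists_energy_eq_iInf (conjDiag V q) (conjDiag W E)
  -- This rotation is chosen so that the matrix between the eigenbases, `W⁻¹ U V`, is `X`.
  have h := heq.symm.le.trans (hle (W * X * V⁻¹))
  rw [energy_conj_conjDiag] at h
  have hX : W⁻¹ * (W * X * V⁻¹) * V = X := by group
  rwa [hX] at h

end Mixing

/-! ### Bounds for `n` copies -/

section Copies

variable {d : ℕ}

theorem ergotropyPerCopy_eq {n : ℕ} (hn : 1 ≤ n) (ρ H : Matrix (Fin d) (Fin d) ℂ)
    (hρ : ρ.trace = 1) : ergotropyPerCopy n ρ H =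
      energy ρ H - minEnergy (tensorPow n ρ) (sumHamiltonian n H) / n := by
  have hn' : (n : ℝ) ≠ 0 := by positivity
  rw [ergotropyPerCopy, ergotropy, energy_tensorPow ρ H hρ, ← minEnergy, sub_div,
    mul_div_cancel_left₀ _ hn']

theorem isGibbsState_conjDiag_iff [Nonempty (Fin d)] (W : Matrix.unitaryGroup (Fin d) ℂ)
    {E : Fin d → ℝ} {i₀ : Fin d} (h₀ : ∀ j, j ≠ i₀ → E i₀ < E j)
    (ω : Matrix (Fin d) (Fin d) ℂ) :
    IsGibbsState (conjDiag W E) ω ↔ ∃ v, IsGibbsVector E i₀ v ∧ ω = conjDiag W v := by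
  have hg : gibbsState (conjDiag W E) = fun β => conjDiag W (gibbsWeight E β) :=
    funext fun β => gibbsState_conjDiag W E β
  have hlim : Tendsto (gibbsState (conjDiag W E)) atTop (𝓝 (conjDiag W (Pi.single i₀ 1))) := by
    rw [hg]
    exact ((continuous_conjDiag W).tendsto _).comp (tendsto_gibbsWeight E h₀)
  constructor
  · rintro (⟨β, hβ, rfl⟩ | h)
    · exact ⟨_, Or.inl ⟨β, hβ, rfl⟩, congrFun hg β⟩
    · exact ⟨_, Or.inr rfl, tendsto_nhds_unique h hlim⟩
  · rintro ⟨v, ⟨β, hβ, rfl⟩ | rfl, rfl⟩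
    · exact Or.inl ⟨β, hβ, (congrFun hg β).symm⟩
    · exact Or.inr hlim

variable {E p v : Fin d → ℝ} {i₀ : Fin d}

/-- The case `β = 0`, where one can neither divide by `β` nor go hotter: the uniform spectrum is
fixed by every rotation, so the energy is exact. -/
theorem mixed_energy_gibbsWeight_zero [Nonempty (Fin d)] (n : ℕ)
    (X : Matrix.unitaryGroup (Fin n → Fin d) ℂ) :
    ∑ f, ∑ g, Complex.normSq (X f g) * (∏ k, gibbsWeight E 0 (g k)) * ∑ k, E (f k) =
      n * ∑ i, gibbsWeight E 0 i * E i := by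
  rw [← sum_prod_mul_sum n (sum_gibbsWeight E 0)]
  simp only [gibbsWeight_zero]
  exact mixed_energy_const X _ _

theorem le_mixed_energy_tensor [Nonempty (Fin d)] (h₀ : ∀ j, j ≠ i₀ → E i₀ < E j)
    (hp : ∀ i, 0 ≤ p i) (hs : ∑ i, p i = 1) (hv : IsGibbsVector E i₀ v)
    (h : shannonEntropy v = shannonEntropy p) (n : ℕ)
    (X : Matrix.unitaryGroup (Fin n → Fin d) ℂ) :
    n * ∑ i, v i * E i ≤
      ∑ f, ∑ g, Complex.normSq (X f g) * (∏ k, p (g k)) * ∑ k, E (f k) := by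
  have hq0 : ∀ f : Fin n → Fin d, 0 ≤ ∏ k, p (f k) := fun f => Finset.prod_nonneg fun k _ => hp _
  have hq1 := sum_prod_eq_one n hs
  rcases hv with ⟨β, hβ, rfl⟩ | rfl
  · rcases hβ.eq_or_lt with rfl | hβ
    · rw [gibbsWeight_zero_eq_of_le E hp hs h.le, mixed_energy_gibbsWeight_zero]
    -- After substituting `S(p) = β e + log Z`, with `e` the one-copy thermal energy, the terms `n
    -- log Z` cancel.
    · have h1 := shannonEntropy_le_mixed_energy X hq0 hq1 (fun f => ∑ k, E (f k)) β
      rw [shannonEntropy_prod n hs, ← h, shannonEntropy_gibbsWeight, sum_exp_sum, Real.log_pow] at h1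
      refine le_of_mul_le_mul_left ?_ hβ
      linarith
  · have h1 : ∑ i, (Pi.single i₀ 1 : Fin d → ℝ) i * E i = E i₀ := by
      simp [Pi.single_apply]
    rw [h1]
    refine le_mixed_energy X hq0 hq1 fun f => ?_
    have h2 : ∀ j, E i₀ ≤ E j := fun j => by
      rcases eq_or_ne j i₀ with rfl | hj
      · exact le_rfl
      · exact (h₀ j hj).le
    have := Finset.card_nsmul_le_sum Finset.univ (fun k => E (f k)) (E i₀) fun k _ => h2 (f k)
    simpa using this

theorem eventually_exists_mixed_energy_le [Nonempty (Fin d)] (hE : Function.Injective E)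
    (h₀ : ∀ j, j ≠ i₀ → E i₀ < E j) (hp : ∀ i, 0 ≤ p i) (hs : ∑ i, p i = 1)
    (hv : IsGibbsVector E i₀ v) (h : shannonEntropy v = shannonEntropy p) {ε : ℝ} (hε : 0 < ε) :
    ∀ᶠ n : ℕ in atTop, ∃ X : Matrix.unitaryGroup (Fin n → Fin d) ℂ,
      ∑ f, ∑ g, Complex.normSq (X f g) * (∏ k, p (g k)) * ∑ k, E (f k) ≤
        n * (∑ i, v i * E i + ε) := by
  by_cases h1 : p = gibbsWeight E 0
  · have h2 : v = gibbsWeight E 0 :=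
      hv.eq_of_entropy_eq hE (Or.inl ⟨0, le_rfl, rfl⟩) (h.trans (h1 ▸ rfl))
    refine Eventually.of_forall fun n => ⟨1, ?_⟩
    rw [h1, h2, mixed_energy_gibbsWeight_zero]
    exact mul_le_mul_of_nonneg_left (le_add_of_nonneg_right hε.le) n.cast_nonneg
  · have h2 : v ≠ gibbsWeight E 0 := fun h2 =>
      h1 (gibbsWeight_zero_eq_of_le E hp hs (h2 ▸ h.le))
    obtain ⟨β, hβ, hS, he⟩ := hv.exists_hotter hE h₀ hs h h1 h2 (half_pos hε)
    filter_upwards [eventually_exists_perm E hp hs hβ (half_pos hε) hS] with n ⟨π, hπ⟩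
    refine ⟨permUnitary π⁻¹, ?_⟩
    rw [mixed_energy_permUnitary π (fun g => ∏ k, p (g k)) (fun f => ∑ k, E (f k))]
    exact hπ.trans (mul_le_mul_of_nonneg_left (by linarith) n.cast_nonneg)

end Copies

end

end QuantumBattery

/-! ### Return to density matrices -/

open QuantumBattery
theorem theorem3 {d : ℕ} (H ρ : Matrix (Fin d) (Fin d) ℂ)
    (hH : H.IsHermitian) (hnd : Function.Injective hH.eigenvalues)
    (hρ : IsDensityMatrix ρ) :
    (∃! ω : Matrix (Fin d) (Fin d) ℂ,
      IsGibbsState H ω ∧ vonNeumannEntropy ω = vonNeumannEntropy ρ) ∧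
    ∀ ω : Matrix (Fin d) (Fin d) ℂ,
      IsGibbsState H ω → vonNeumannEntropy ω = vonNeumannEntropy ρ →
      (∀ n : ℕ, 1 ≤ n → ergotropyPerCopy n ρ H ≤ energy ρ H - energy ω H) ∧
      Tendsto (fun n : ℕ => ergotropyPerCopy n ρ H) atTop (𝓝 (energy ρ H - energy ω H)) := by
  have hρH := hρ.posSemidef.isHermitian
  set W := hH.eigenvectorUnitary
  set V := hρH.eigenvectorUnitary
  set E := hH.eigenvalues
  set p := hρH.eigenvalues
  have hHd : H = conjDiag W E := eq_conjDiag hH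
  have hρd : ρ = conjDiag V p := eq_conjDiag hρH
  have hp : ∀ i, 0 ≤ p i := hρ.posSemidef.eigenvalues_nonneg
  have hs : ∑ i, p i = 1 := by
    have h := conjDiag_trace V p
    rw [← hρd, hρ.trace_eq_one] at h
    exact_mod_cast h.symm
  -- Trace one excludes `d = 0`.
  have hne : Nonempty (Fin d) := by
    by_contra h
    rw [not_nonempty_iff] at h
    simp at hs
  obtain ⟨i₀, hi₀⟩ := Finite.exists_min E
  have h₀ : ∀ j, j ≠ i₀ → E i₀ < E j := fun j hj => (hi₀ j).lt_of_ne (hnd.ne hj.symm)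
  have hSρ : vonNeumannEntropy ρ = shannonEntropy p := by
    rw [hρd]
    exact vonNeumannEntropy_conjDiag V p
  have hSω : ∀ v, vonNeumannEntropy (conjDiag W v) = shannonEntropy v :=
    vonNeumannEntropy_conjDiag W
  have hiff := isGibbsState_conjDiag_iff W h₀
  rw [← hHd] at hiff
  refine ⟨?_, fun ω hω hSe => ?_⟩
  · obtain ⟨v, hv, hve⟩ := exists_isGibbsVector h₀ hp hs
    refine ⟨conjDiag W v, ⟨(hiff _).2 ⟨v, hv, rfl⟩, ?_⟩, ?_⟩
    · rw [hSω, hSρ, hve]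
    · rintro ω ⟨hω, hSe⟩
      obtain ⟨w, hw, rfl⟩ := (hiff ω).1 hω
      rw [hSω, hSρ, ← hve] at hSe
      rw [hw.eq_of_entropy_eq hnd hv hSe]
  · obtain ⟨v, hv, rfl⟩ := (hiff ω).1 hω
    rw [hSω, hSρ] at hSe
    have heω : energy (conjDiag W v) H = ∑ i, v i * E i := by
      rw [hHd]
      exact energy_conjDiag_self W v E
    have hlow : ∀ n : ℕ, 1 ≤ n → ergotropyPerCopy n ρ H ≤
        energy ρ H - energy (conjDiag W v) H := by
      intro n hn
      have hn' : (0 : ℝ) < n := by exact_mod_cast hn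
      rw [ergotropyPerCopy_eq hn ρ H hρ.trace_eq_one]
      refine sub_le_sub_left ?_ _
      rw [le_div_iff₀ hn', mul_comm, heω, hHd, hρd, tensorPow_conjDiag, sumHamiltonian_conjDiag]
      exact le_minEnergy_conjDiag _ _ (le_mixed_energy_tensor h₀ hp hs hv hSe n)
    refine ⟨hlow, tendsto_order.2 ⟨fun a ha => ?_, fun a ha => ?_⟩⟩
    -- Half of the distance to `a`, so that the resulting bound lies strictly above `a`.
    · have hε : 0 < (energy ρ H - energy (conjDiag W v) H - a) / 2 := by linarith
      filter_upwards [eventually_exists_mixed_energy_le hnd h₀ hp hs hv hSe hε,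
        eventually_ge_atTop 1] with n ⟨X, hX⟩ hn
      have hn' : (0 : ℝ) < n := by exact_mod_cast hn
      have h1 := (minEnergy_conjDiag_le (unitaryPow n V) (unitaryPow n W) X
        (fun f => ∏ k, p (f k)) (fun f => ∑ k, E (f k))).trans hX
      rw [← tensorPow_conjDiag, ← sumHamiltonian_conjDiag, ← hHd, ← hρd, ← heω, mul_comm,
        ← div_le_iff₀ hn'] at h1
      rw [ergotropyPerCopy_eq hn ρ H hρ.trace_eq_one]
      linarith
    · filter_upwards [eventually_ge_atTop 1] with n hn
      exact (hlow n hn).trans_lt ha
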